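/- Let $(M,\omega)$ be a (finite-dimensional, Hausdorff, $\sigma$-compact, boundaryless) symplectic manifold: $\omega$ is a smooth, closed, nondegenerate $2$-form. For $f\in C^\infty(M)=C^\infty(M,\mathbb R)$ let $X_f$ be the Hamiltonian vector field defined by $\omega(X_f,\cdot)=df$, and let $\{f,g\}:=-\omega(X_f,X_g)$ be the Poisson bracket. Let $\hbar$ be a nonzero real number and let $L\to M$ be a smooth complex line bundle with a connection $\nabla$, i.e. a family of $\mathbb C$-linear operators $\nabla_X:\Gamma(L)\to\Gamma(L)$ on the space of smooth sections, indexed by the smooth vector fields $X$ on $M$, which is $C^\infty(M)$-linear in $X$ and satisfies $\nabla_X(fs)=f\nabla_Xs+(Xf)s$. Assume that its curvature $F(X,Y)=\nabla_X\nabla_Y-\nabla_Y\nabla_X-\nabla_{[X,Y]}$ satisfies $F=-\frac{i}{\hbar}\omega$, that is, $F(X,Y)s=-\frac{i}{\hbar}\omega(X,Y)\,s$ for all smooth vector fields $X,Y$ and all $s\in\Gamma(L)$. For $f\in C^\infty(M)$ put $$Q(f):=-i\hbar\nabla_{X_f}-f\ \in\ \operatorname{End}_{\mathbb C}(\Gamma(L)),\qquad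 Q'(f):=\nabla_{X_f}-\frac{i}{\hbar}f\ \in\ \operatorname{End}_{\mathbb C}(\Gamma(L)),$$ where $f$ also denotes the operator of multiplication by $f$. Then: 1. $(C^\infty(M),\{\cdot,\cdot\})$ is a real Lie algebra: the bracket is $\mathbb R$-bilinear, skew-symmetric and satisfies the Jacobi identity. 2. $f\mapsto Q(f)$ is $\mathbb R$-linear, and $[Q(f),Q(g)]=-i\hbar\,Q(\{f,g\})$ for all $f,g\in C^\infty(M)$, where $[A,B]=AB-BA$. That is, $Q$ is a homomorphism of Lie algebras up to the factor $-i\hbar$. 3. $f\mapsto Q'(f)$ is $\mathbb R$-linear, and $[Q'(f),Q'(g)]=Q'(\{f,g\})$ for all $f,g\in C^\infty(M)$. That is, $Q'$ is a homomorphism of Lie algebras from $(C^\infty(M),\{\cdot,\cdot\})$ to $(\operatorname{End}_{\mathbb C}(\Gamma(L)),[\cdot,\cdot])$. -/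

import Mathlib

open Bundle
open scoped Manifold ContDiff

namespace Prequantum

noncomputable section

/-! ### Smooth functions, vector fields, sections -/

/-- Real-valued smooth functions `C^∞(M)`; `M` is a manifold without boundary modelled on `E`. -/
abbrev SmoothFun (E M : Type*) [NormedAddCommGroup E] [NormedSpace ℝ E]
    [TopologicalSpace M] [ChartedSpace E M] : Type _ :=
  C^∞⟮𝓘(ℝ, E), M; 𝓘(ℝ, ℝ), ℝ⟯

/-- Smooth vector fields `Γ(TM)`. -/
abbrev VecField (E M : Type*) [NormedAddCommGroup E] [NormedSpace ℝ E]
    [TopologicalSpace M] [ChartedSpace E M] [IsManifold 𝓘(ℝ, E) ∞ M] : Type _ :=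
  Cₛ^∞⟮𝓘(ℝ, E); E, (TangentSpace 𝓘(ℝ, E) : M → Type _)⟯

/-- Smooth sections `Γ(L)` of a bundle `L → M` with fibre `ℂ`. -/
abbrev LineSection (E : Type*) {M : Type*} [NormedAddCommGroup E] [NormedSpace ℝ E]
    [TopologicalSpace M] [ChartedSpace E M] (L : M → Type*) [TopologicalSpace (TotalSpace ℂ L)]
    [∀ x, TopologicalSpace (L x)] [FiberBundle ℂ L] : Type _ :=
  Cₛ^∞⟮𝓘(ℝ, E); ℂ, L⟯

section Multiplication

variable {E M : Type*} [NormedAddCommGroup E] [NormedSpace ℝ E]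
  [TopologicalSpace M] [ChartedSpace E M]

/-- The product `f s` of a smooth function and a smooth section of a real vector bundle. -/
def fmul {F : Type*} [NormedAddCommGroup F] [NormedSpace ℝ F] {V : M → Type*}
    [TopologicalSpace (TotalSpace F V)] [∀ x, TopologicalSpace (V x)] [FiberBundle F V]
    [∀ x, AddCommGroup (V x)] [∀ x, Module ℝ (V x)] [VectorBundle ℝ F V]
    (f : SmoothFun E M) (s : Cₛ^∞⟮𝓘(ℝ, E); F, V⟯) : Cₛ^∞⟮𝓘(ℝ, E); F, V⟯ :=
  ⟨fun x => f x • s x, f.contMDiff.smul_section s.contMDiff⟩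

end Multiplication

section ComplexSections

variable {E M : Type*} [NormedAddCommGroup E] [NormedSpace ℝ E]
  [TopologicalSpace M] [ChartedSpace E M]
  {L : M → Type*} [TopologicalSpace (TotalSpace ℂ L)] [∀ x, TopologicalSpace (L x)]
  [FiberBundle ℂ L] [∀ x, AddCommGroup (L x)] [∀ x, Module ℂ (L x)] [VectorBundle ℂ ℂ L]

theorem contMDiff_complex_smul (c : ℂ) (s : LineSection E L) :
    ContMDiff 𝓘(ℝ, E) (𝓘(ℝ, E).prod 𝓘(ℝ, ℂ)) ∞
      (fun x => TotalSpace.mk' ℂ x (c • s x)) := by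
  intro x₀
  have hs := s.contMDiff x₀
  rw [contMDiffAt_section] at hs ⊢
  have h2 : ContMDiffAt 𝓘(ℝ, E) 𝓘(ℝ, ℂ) ∞
      (fun x => c * (trivializationAt ℂ L x₀ ⟨x, s x⟩).2) x₀ :=
    (ContinuousLinearMap.mul ℝ ℂ c).contMDiff.contMDiffAt.comp x₀ hs
  refine h2.congr_of_eventuallyEq ?_
  filter_upwards [(trivializationAt ℂ L x₀).open_baseSet.mem_nhds
    (mem_baseSet_trivializationAt ℂ L x₀)] with x hx
  exact ((trivializationAt ℂ L x₀).linear ℂ hx).map_smul c (s x)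

variable [∀ x, Module ℝ (L x)] [VectorBundle ℝ ℂ L]

/-- Fibrewise multiplication of smooth sections by complex constants. -/
instance instSMulComplex : SMul ℂ (LineSection E L) :=
  ⟨fun c s => ⟨fun x => c • s x, contMDiff_complex_smul c s⟩⟩

/-- `Γ(L)` is a complex vector space. -/
instance instModuleComplex : Module ℂ (LineSection E L) :=
  ContMDiffSection.coe_injective.module ℂ
    (ContMDiffSection.coeAddHom 𝓘(ℝ, E) ℂ ∞ L) (fun _ _ => rfl)

variable [∀ x, IsScalarTower ℝ ℂ (L x)]

/-- Multiplication by a real smooth function, as an element of `End(Γ(L))`. -/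
def mulOp (f : SmoothFun E M) : Module.End ℂ (LineSection E L) where
  toFun s := fmul f s
  map_add' s t := by
    ext x
    exact smul_add (f x) (s x) (t x)
  map_smul' c s := by
    ext x
    change f x • (c • s x) = c • (f x • s x)
    rw [← algebraMap_smul ℂ (f x) (c • s x), ← algebraMap_smul ℂ (f x) (s x), smul_comm]

end ComplexSections

section Manifold

variable {E M : Type*} [NormedAddCommGroup E] [NormedSpace ℝ E]
  [TopologicalSpace M] [ChartedSpace E M]

/-- The derivative `X f = df(X)` of a smooth function along a smooth vector field. -/
def lieDeriv [IsManifold 𝓘(ℝ, E) ∞ M] (X : VecField E M) (f : SmoothFun E M) : SmoothFun E M :=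
  ⟨fun x => mvfderiv 𝓘(ℝ, E) f x (X x), by
    have h : ContMDiff 𝓘(ℝ, E).tangent 𝓘(ℝ, ℝ).tangent ∞ (tangentMap 𝓘(ℝ, E) 𝓘(ℝ, ℝ) f) :=
      f.contMDiff.contMDiff_tangentMap (m := ∞) (n := ∞) le_rfl
    exact (contMDiff_snd_tangentBundle_modelSpace ℝ 𝓘(ℝ, ℝ)).comp (h.comp X.contMDiff)⟩

/-- The commutator `[X, Y]` of smooth vector fields. -/
def bracket [IsManifold 𝓘(ℝ, E) ∞ M] [CompleteSpace E] (X Y : VecField E M) : VecField E M :=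
  ⟨VectorField.mlieBracket 𝓘(ℝ, E) X Y, by
    have : IsManifold 𝓘(ℝ, E) (((⊤ : ℕ∞) : ℕ∞ω) + 1) M := ‹IsManifold 𝓘(ℝ, E) ∞ M›
    have : IsManifold 𝓘(ℝ, E) (minSmoothness ℝ 2) M := by
      rw [minSmoothness_of_isRCLikeNormedField]; infer_instance
    have : IsManifold 𝓘(ℝ, E) (minSmoothness ℝ 3) M := by
      rw [minSmoothness_of_isRCLikeNormedField]; exact .of_le (n := ∞) ENat.LEInfty.out
    exact ContDiff.mlieBracket_vectorField (m := (⊤ : ℕ∞)) (n := (⊤ : ℕ∞))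
      X.contMDiff Y.contMDiff (by simp)⟩

/-! ### Symplectic forms -/

/-- The expression of a (not necessarily smooth) 2-form in the chart at `x₀`, that is its
pullback along the inverse of the chart. Meaningful on the target of the chart. -/
def chartForm (Ω : ∀ x : M, TangentSpace 𝓘(ℝ, E) x [⋀^Fin 2]→L[ℝ] ℝ) (x₀ : M) (y : E) :
    E [⋀^Fin 2]→L[ℝ] ℝ :=
  (Ω ((extChartAt 𝓘(ℝ, E) x₀).symm y)).compContinuousLinearMap
    (mfderiv 𝓘(ℝ, E) 𝓘(ℝ, E) (extChartAt 𝓘(ℝ, E) x₀).symm y)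

variable (E M) in
/-- A symplectic form: a smooth, closed, nondegenerate 2-form. -/
structure SymplecticForm where
  toFun : ∀ x : M, TangentSpace 𝓘(ℝ, E) x [⋀^Fin 2]→L[ℝ] ℝ
  smooth : ∀ x₀ : M, ContDiffOn ℝ ∞ (chartForm toFun x₀) (extChartAt 𝓘(ℝ, E) x₀).target
  closed : ∀ x₀ : M, ∀ y ∈ (extChartAt 𝓘(ℝ, E) x₀).target, extDeriv (chartForm toFun x₀) y = 0
  nondegenerate : ∀ (x : M) (v : TangentSpace 𝓘(ℝ, E) x), (∀ w, toFun x ![v, w] = 0) → v = 0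

instance : CoeFun (SymplecticForm E M)
    (fun _ => ∀ x : M, TangentSpace 𝓘(ℝ, E) x [⋀^Fin 2]→L[ℝ] ℝ) :=
  ⟨SymplecticForm.toFun⟩

/-- An alternating 2-form on a vector space as a bilinear map. -/
def flat {V : Type*} [AddCommGroup V] [Module ℝ V] [TopologicalSpace V] (a : V [⋀^Fin 2]→L[ℝ] ℝ) :
    V →ₗ[ℝ] V →ₗ[ℝ] ℝ :=
  LinearMap.mk₂ ℝ (fun v w => a ![v, w])
    (fun v v' w => a.toContinuousMultilinearMap.toMultilinearMap.cons_add ![w] v v')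
    (fun c v w => a.toContinuousMultilinearMap.toMultilinearMap.cons_smul ![w] c v)
    (fun v w w' => by
      have e (u : V) : Function.update ![v, 0] 1 u = ![v, u] := by
        ext i; fin_cases i <;> simp
      simpa only [e] using a.map_update_add ![v, 0] 1 w w')
    (fun c v w => by
      have e (u : V) : Function.update ![v, 0] 1 u = ![v, u] := by
        ext i; fin_cases i <;> simp
      simpa only [e] using a.map_update_smul ![v, 0] 1 c w)

theorem flat_surjective {V : Type*} [AddCommGroup V] [Module ℝ V] [TopologicalSpace V]
    [FiniteDimensional ℝ V] (a : V [⋀^Fin 2]→L[ℝ] ℝ) (h : ∀ v, (∀ w, a ![v, w] = 0) → v = 0) :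
    Function.Surjective (flat a) := by
  refine (LinearMap.injective_iff_surjective_of_finrank_eq_finrank
    Subspace.dual_finrank_eq.symm).1 ?_
  rw [injective_iff_map_eq_zero]
  exact fun v hv => h v fun w => LinearMap.congr_fun hv w

theorem SymplecticForm.exists_hamiltonian [FiniteDimensional ℝ E] (Ω : SymplecticForm E M)
    (f : SmoothFun E M) (x : M) :
    ∃ v : TangentSpace 𝓘(ℝ, E) x, ∀ w, Ω x ![v, w] = mvfderiv 𝓘(ℝ, E) f x w := by
  have : FiniteDimensional ℝ (TangentSpace 𝓘(ℝ, E) x) := inferInstanceAs (FiniteDimensional ℝ E)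
  obtain ⟨v, hv⟩ := flat_surjective (Ω x) (Ω.nondegenerate x)
    (mvfderiv 𝓘(ℝ, E) f x : TangentSpace 𝓘(ℝ, E) x →L[ℝ] ℝ).toLinearMap
  exact ⟨v, fun w => LinearMap.congr_fun hv w⟩

/-- The vector `v = X_f(x)` determined by `Ω(v, ·) = df` at `x`. -/
def SymplecticForm.hamiltonianAt [FiniteDimensional ℝ E] (Ω : SymplecticForm E M)
    (f : SmoothFun E M) (x : M) : TangentSpace 𝓘(ℝ, E) x :=
  (Ω.exists_hamiltonian f x).choose

theorem SymplecticForm.hamiltonianAt_spec [FiniteDimensional ℝ E] (Ω : SymplecticForm E M)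
    (f : SmoothFun E M) (x : M) (w : TangentSpace 𝓘(ℝ, E) x) :
    Ω x ![Ω.hamiltonianAt f x, w] = mvfderiv 𝓘(ℝ, E) f x w :=
  (Ω.exists_hamiltonian f x).choose_spec w

theorem SymplecticForm.contMDiff_hamiltonianAt [FiniteDimensional ℝ E]
    [IsManifold 𝓘(ℝ, E) ∞ M] (Ω : SymplecticForm E M)
    (f : SmoothFun E M) :
    ContMDiff 𝓘(ℝ, E) (𝓘(ℝ, E).prod 𝓘(ℝ, E)) ∞
      (fun x => TotalSpace.mk' E x (Ω.hamiltonianAt f x)) := by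
  intro x₀
  set φ := extChartAt 𝓘(ℝ, E) x₀ with hφ
  have hopen : IsOpen φ.target := isOpen_extChartAt_target x₀
  -- the coordinates of the Hamiltonian vector field
  let V : E → E := fun y => mfderiv 𝓘(ℝ, E) 𝓘(ℝ, E) φ (φ.symm y) (Ω.hamiltonianAt f (φ.symm y))
  let B : E → E →L[ℝ] E →L[ℝ] ℝ := fun y =>
    LinearMap.toContinuousLinearMap
      (LinearMap.toContinuousLinearMap.toLinearMap ∘ₗ flat (chartForm Ω x₀ y))
  have hB (y v w) : B y v w = chartForm Ω x₀ y ![v, w] := rfl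
  have hBsmooth : ContDiffOn ℝ ∞ B φ.target := by
    refine contDiffOn_clm_apply.2 fun v => contDiffOn_clm_apply.2 fun w => ?_
    simp_rw [hB]
    exact (ContinuousAlternatingMap.apply ℝ E ℝ ![v, w]).contDiff.comp_contDiffOn (Ω.smooth x₀)
  have hDsymm (y) (hy : y ∈ φ.target) (w : TangentSpace 𝓘(ℝ, E) (φ.symm y)) :
      mfderiv 𝓘(ℝ, E) 𝓘(ℝ, E) φ.symm y (mfderiv 𝓘(ℝ, E) 𝓘(ℝ, E) φ (φ.symm y) w) = w := by
    have := mfderivWithin_extChartAt_symm_comp_mfderiv_extChartAt (I := 𝓘(ℝ, E)) hy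
    simp only [modelWithCornersSelf_coe, Set.range_id, mfderivWithin_univ] at this
    exact DFunLike.congr_fun this w
  have hfsmooth : ContDiffOn ℝ ∞ (f ∘ φ.symm) φ.target :=
    (f.contMDiff.comp_contMDiffOn (contMDiffOn_extChartAt_symm x₀)).contDiffOn
  have hdf : ContDiffOn ℝ ∞ (fderiv ℝ (f ∘ φ.symm)) φ.target :=
    hfsmooth.fderiv_of_isOpen hopen le_rfl
  have hBV (y) (hy : y ∈ φ.target) : B y (V y) = fderiv ℝ (f ∘ φ.symm) y := by
    ext w
    have hφd : MDifferentiableAt 𝓘(ℝ, E) 𝓘(ℝ, E) φ.symm y :=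
      ((contMDiffOn_extChartAt_symm (n := ∞) x₀).contMDiffAt (hopen.mem_nhds hy)).mdifferentiableAt
        (by simp)
    have hfd : MDifferentiableAt 𝓘(ℝ, E) 𝓘(ℝ, ℝ) f (φ.symm y) := f.mdifferentiableAt
    rw [hB, ← mfderiv_eq_fderiv, mfderiv_comp y hfd hφd]
    refine Eq.trans ?_ (Ω.hamiltonianAt_spec f (φ.symm y) (mfderiv 𝓘(ℝ, E) 𝓘(ℝ, E) φ.symm y w))
    refine congrArg (Ω (φ.symm y)) ?_
    funext i
    fin_cases i
    · exact hDsymm y hy _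
    · rfl
  have hBinv (y) (hy : y ∈ φ.target) : (B y).IsInvertible := by
    have hnd : ∀ u, (∀ w, chartForm Ω x₀ y ![u, w] = 0) → u = 0 := by
      intro u hu
      have hinvs := isInvertible_mfderivWithin_extChartAt_symm (I := 𝓘(ℝ, E)) hy
      simp only [modelWithCornersSelf_coe, Set.range_id, mfderivWithin_univ] at hinvs
      obtain ⟨e, he⟩ := hinvs
      have he' (w : E) : e w = mfderiv 𝓘(ℝ, E) 𝓘(ℝ, E) φ.symm y w := DFunLike.congr_fun he w
      have h0 : e u = 0 := by
        refine Ω.nondegenerate _ _ fun w => Eq.trans ?_ (hu (e.symm w))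
        refine congrArg (Ω (φ.symm y)) ?_
        funext i
        fin_cases i
        · exact he' u
        · exact (e.apply_symm_apply w).symm.trans (he' _)
      exact e.map_eq_zero_iff.1 h0
    have hinj : Function.Injective (flat (chartForm Ω x₀ y)) := by
      rw [injective_iff_map_eq_zero]
      exact fun u hu => hnd u fun w => LinearMap.congr_fun hu w
    exact ⟨((LinearEquiv.ofBijective (flat (chartForm Ω x₀ y))
      ⟨hinj, flat_surjective _ hnd⟩).trans LinearMap.toContinuousLinearMap).toContinuousLinearEquiv,
      rfl⟩
  have hV : ContDiffOn ℝ ∞ V φ.target := by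
    have h1 : ContDiffOn ℝ ∞ (fun y => (B y).inverse (fderiv ℝ (f ∘ φ.symm) y)) φ.target := by
      refine ContDiffOn.clm_apply (fun y hy => ?_) hdf
      exact ((hBinv y hy).contDiffAt_map_inverse).comp_contDiffWithinAt y (hBsmooth y hy)
    refine h1.congr fun y hy => ?_
    rw [eq_comm, (hBinv y hy).inverse_apply_eq, hBV y hy]
  rw [contMDiffAt_section]
  have h2 : ContMDiffAt 𝓘(ℝ, E) 𝓘(ℝ, E) ∞ (V ∘ φ) x₀ :=
    (hV.contDiffAt (hopen.mem_nhds (mem_extChartAt_target x₀))).contMDiffAt.comp x₀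
      contMDiffAt_extChartAt
  refine h2.congr_of_eventuallyEq ?_
  filter_upwards [extChartAt_source_mem_nhds (I := 𝓘(ℝ, E)) x₀] with x hx
  have hx' : x ∈ (chartAt E x₀).source := by rwa [extChartAt_source] at hx
  change _ = mfderiv 𝓘(ℝ, E) 𝓘(ℝ, E) φ (φ.symm (φ x)) (Ω.hamiltonianAt f (φ.symm (φ x)))
  rw [φ.left_inv hx, ← TangentBundle.continuousLinearMapAt_trivializationAt hx']
  exact (Trivialization.continuousLinearMapAt_apply_of_mem (R := ℝ) (F := E)
    (trivializationAt E (TangentSpace 𝓘(ℝ, E)) x₀) (b := x) hx' (Ω.hamiltonianAt f x)).symm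

/-- The Hamiltonian vector field `X_f`, given by `ι_{X_f} Ω = df`. -/
def SymplecticForm.hamiltonian [FiniteDimensional ℝ E]
    [IsManifold 𝓘(ℝ, E) ∞ M] (Ω : SymplecticForm E M)
    (f : SmoothFun E M) : VecField E M :=
  ⟨Ω.hamiltonianAt f, Ω.contMDiff_hamiltonianAt f⟩

/-- The Poisson bracket `{f, g} = -Ω(X_f, X_g)`. -/
def SymplecticForm.poisson [FiniteDimensional ℝ E]
    [IsManifold 𝓘(ℝ, E) ∞ M] (Ω : SymplecticForm E M)
    (f g : SmoothFun E M) : SmoothFun E M :=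
  ⟨fun x => -Ω x ![Ω.hamiltonian f x, Ω.hamiltonian g x], by
    refine (lieDeriv (Ω.hamiltonian g) f).contMDiff.neg.congr fun x => ?_
    exact congrArg Neg.neg (Ω.hamiltonianAt_spec f x (Ω.hamiltonianAt g x))⟩

end Manifold

/-! ### Connections on complex line bundles -/

section Connection

variable (E : Type*) {M : Type*} [NormedAddCommGroup E] [NormedSpace ℝ E]
  [TopologicalSpace M] [ChartedSpace E M] [IsManifold 𝓘(ℝ, E) ∞ M]
  (L : M → Type*) [TopologicalSpace (TotalSpace ℂ L)] [∀ x, TopologicalSpace (L x)]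
  [FiberBundle ℂ L] [∀ x, AddCommGroup (L x)] [∀ x, Module ℂ (L x)] [VectorBundle ℂ ℂ L]
  [∀ x, Module ℝ (L x)] [∀ x, IsScalarTower ℝ ℂ (L x)] [VectorBundle ℝ ℂ L]

/-- A connection on the complex line bundle `L`: `ℂ`-linear operators `∇_X` on `Γ(L)`, one for
each smooth vector field `X`, depending `C^∞(M)`-linearly on `X` and obeying the Leibniz rule. -/
structure Connection where
  nabla : VecField E M → Module.End ℂ (LineSection E L)
  add_field : ∀ X Y : VecField E M, nabla (X + Y) = nabla X + nabla Y
  fmul_field : ∀ (f : SmoothFun E M) (X : VecField E M) (s : LineSection E L),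
    nabla (fmul f X) s = fmul f (nabla X s)
  leibniz : ∀ (X : VecField E M) (f : SmoothFun E M) (s : LineSection E L),
    nabla X (fmul f s) = fmul f (nabla X s) + fmul (lieDeriv X f) s

variable {E L}

/-- The curvature `F(X, Y) = ∇_X ∇_Y - ∇_Y ∇_X - ∇_{[X, Y]}`. -/
def Connection.curvature [CompleteSpace E] (D : Connection E L) (X Y : VecField E M) :
    Module.End ℂ (LineSection E L) :=
  D.nabla X * D.nabla Y - D.nabla Y * D.nabla X - D.nabla (bracket X Y)

/-- The prequantum condition `F = -(i/ħ) Ω`. -/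
def Connection.IsPrequantum [CompleteSpace E] (D : Connection E L) (Ω : SymplecticForm E M)
    (ħ : ℝ) : Prop :=
  ∀ (X Y : VecField E M) (s : LineSection E L) (x : M),
    D.curvature X Y s x = (-(Complex.I / (ħ : ℂ)) * ((Ω x ![X x, Y x] : ℝ) : ℂ)) • s x

/-- The prequantum operator `Q(f) = -iħ ∇_{X_f} - f`. -/
def Connection.quantize [FiniteDimensional ℝ E] (D : Connection E L) (Ω : SymplecticForm E M)
    (ħ : ℝ) (f : SmoothFun E M) : Module.End ℂ (LineSection E L) :=
  (-(Complex.I * (ħ : ℂ))) • D.nabla (Ω.hamiltonian f) - mulOp f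

/-- The rescaled prequantum operator `∇_{X_f} - (i/ħ) f`. -/
def Connection.quantize' [FiniteDimensional ℝ E] (D : Connection E L) (Ω : SymplecticForm E M)
    (ħ : ℝ) (f : SmoothFun E M) : Module.End ℂ (LineSection E L) :=
  D.nabla (Ω.hamiltonian f) - (Complex.I / (ħ : ℂ)) • mulOp f

end Connection

/-! ### Lie algebras -/

/-- `b` is the bracket of a real Lie algebra: bilinear, skew-symmetric, with the Jacobi identity. -/
structure IsLieBracket {A : Type*} [AddCommGroup A] [Module ℝ A] (b : A → A → A) : Prop where
  add_left : ∀ x y z, b (x + y) z = b x z + b y z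
  smul_left : ∀ (c : ℝ) (x y : A), b (c • x) y = c • b x y
  skew : ∀ x y, b x y = -b y x
  jacobi : ∀ x y z, b x (b y z) + b y (b z x) + b z (b x y) = 0

end

end Prequantum

/-!
Everything rests on `[X_f, X_g] = X_h` with `h = {f, g}`
(`SymplecticForm.bracket_hamiltonian`). By Cartan's calculus
`ι_{[X_f, X_g]} Ω = L_{X_f} ι_{X_g} Ω - ι_{X_g} L_{X_f} Ω`, where `L_{X_f} Ω = 0` because `Ω` is
closed and `ι_{X_f} Ω` is exact, so the right-hand side is `L_{X_f} dg = d(X_f g) = d{f, g}`; and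
`Ω` is nondegenerate. Both sides being pointwise, the identity is checked at the centre of a chart:
`chartField` and `chartForm` express the data on a vector space, where `lieBracket_hamiltonian`
evaluates `dΩ = 0` on `X_f`, `X_g` and a constant vector field.

Since `{f, g} = X_f g` and vector fields act on functions compatibly with the bracket
(`lieDeriv_bracket`), the identity gives `{{f, g}, h} = {f, {g, h}} - {g, {f, h}}`, which together
with skew-symmetry is the Jacobi identity.

For the operators, the prequantum condition turns into
`[∇_{X_f}, ∇_{X_g}] = ∇_{[X_f, X_g]} + (i/ħ) {f, g}`, and the Leibniz rule into
`[∇_X, f] = X f`. Expanding the commutator of `∇_{X_f} - (i/ħ) f` and `∇_{X_g} - (i/ħ) g` then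
yields `Connection.quantize'_commutator`. The statements about `Q` follow from `Q = -iħ Q'`.
-/

namespace Prequantum

noncomputable section

/-! ### Hamiltonian vector fields on a vector space -/

section Flat

open VectorField

variable {E : Type*} [NormedAddCommGroup E] [NormedSpace ℝ E]

theorem alternating_pair_swap {V : Type*} [AddCommGroup V] [Module ℝ V] [TopologicalSpace V]
    (a : V [⋀^Fin 2]→L[ℝ] ℝ) (v w : V) : a ![v, w] = -a ![w, v] := by
  have h := a.map_swap ![w, v] (show (0 : Fin 2) ≠ 1 by decide)
  refine Eq.trans (congrArg a ?_) h
  ext i; fin_cases i <;> rfl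

theorem fderiv_fderiv_apply {a : E → ℝ} {U : E → E} {y : E} (ha : ContDiffAt ℝ 2 a y)
    (hU : DifferentiableAt ℝ U y) (v : E) :
    fderiv ℝ (fun z => fderiv ℝ a z (U z)) y v =
      fderiv ℝ (fderiv ℝ a) y v (U y) + fderiv ℝ a y (fderiv ℝ U y v) := by
  have h : DifferentiableAt ℝ (fderiv ℝ a) y :=
    (ha.fderiv_right (m := 1) (by norm_num)).differentiableAt (by simp)
  rw [fderiv_clm_apply h hU]
  simp [add_comm]

/-- A vector field acts on functions through the derivative, and the Lie bracket acts as the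
commutator: the second derivatives cancel by symmetry. -/
theorem fderiv_lieBracket {a : E → ℝ} {U V : E → E} {y : E} (ha : ContDiffAt ℝ 2 a y)
    (hU : DifferentiableAt ℝ U y) (hV : DifferentiableAt ℝ V y) :
    fderiv ℝ a y (lieBracket ℝ U V y) =
      fderiv ℝ (fun z => fderiv ℝ a z (V z)) y (U y) -
        fderiv ℝ (fun z => fderiv ℝ a z (U z)) y (V y) := by
  have hs : IsSymmSndFDerivAt ℝ a y := ha.isSymmSndFDerivAt (by simp)
  rw [fderiv_fderiv_apply ha hU, fderiv_fderiv_apply ha hV, hs.eq (V y) (U y), lieBracket_eq,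
    map_sub]
  ring

/-- If `β` is a closed 2-form and `β(U, ·) = da`, `β(V, ·) = db`, then `β([U, V], ·) = d(U b)`.
This is Cartan's formula `ι_{[U, V]} β = L_U ι_V β - ι_V L_U β` with `L_U β = 0`; the proof
evaluates `dβ` on `U`, `V` and a constant vector field. -/
theorem lieBracket_hamiltonian {β : E → E [⋀^Fin 2]→L[ℝ] ℝ} {U V : E → E} {a b : E → ℝ} {y : E}
    (hβ : DifferentiableAt ℝ β y) (hclosed : extDeriv β y = 0)
    (hU : DifferentiableAt ℝ U y) (hV : DifferentiableAt ℝ V y)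
    (ha : ContDiffAt ℝ 2 a y) (hb : ContDiffAt ℝ 2 b y)
    (hUa : ∀ᶠ z in nhds y, ∀ w, β z ![U z, w] = fderiv ℝ a z w)
    (hVb : ∀ᶠ z in nhds y, ∀ w, β z ![V z, w] = fderiv ℝ b z w) (w : E) :
    β y ![lieBracket ℝ U V y, w] = fderiv ℝ (fun z => fderiv ℝ b z (U z)) y w := by
  have H := extDeriv_apply_vectorField (V := ![U, V, fun _ => w]) hβ (by
    intro i
    fin_cases i
    exacts [hU, hV, differentiableAt_const w])
  -- omitting one of the three vector fields leaves the other two in order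
  have e1 : (fun z => β z (Fin.removeNth 0 fun i => (![U, V, fun _ => w] : Fin 3 → E → E) i z))
      = fun z => β z ![V z, w] := by
    ext z; congr 1; ext i; fin_cases i <;> rfl
  have e2 : (fun z => β z (Fin.removeNth 1 fun i => (![U, V, fun _ => w] : Fin 3 → E → E) i z))
      = fun z => β z ![U z, w] := by
    ext z; congr 1; ext i; fin_cases i <;> rfl
  have e3 : (fun z => β z (Fin.removeNth 2 fun i => (![U, V, fun _ => w] : Fin 3 → E → E) i z))
      = fun z => β z ![U z, V z] := by
    ext z; congr 1; ext i; fin_cases i <;> rfl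
  have f1 : (fun z => β z ![V z, w]) =ᶠ[nhds y] fun z => fderiv ℝ b z w := by
    filter_upwards [hVb] with z hz using hz w
  have f2 : (fun z => β z ![U z, w]) =ᶠ[nhds y] fun z => fderiv ℝ a z w := by
    filter_upwards [hUa] with z hz using hz w
  have f3 : (fun z => β z ![U z, V z]) =ᶠ[nhds y] fun z => -fderiv ℝ b z (U z) := by
    filter_upwards [hVb] with z hz
    rw [alternating_pair_swap, hz]
  have f3' : (fun z => -fderiv ℝ b z (U z)) =ᶠ[nhds y] fun z => fderiv ℝ a z (V z) := by
    filter_upwards [hUa, hVb] with z hz hz'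
    rw [← hz, alternating_pair_swap, hz']
  -- `β(U, V)` has the two expressions `-U b` and `V a`; differentiate both along `w`
  have g3 : fderiv ℝ (fun z => -fderiv ℝ b z (U z)) y w
      = -fderiv ℝ (fun z => fderiv ℝ b z (U z)) y w := by
    rw [fderiv_fun_neg]; rfl
  have g3' := g3
  rw [f3'.fderiv_eq, fderiv_fderiv_apply ha hV] at g3'
  have hsa : IsSymmSndFDerivAt ℝ a y := ha.isSymmSndFDerivAt (by simp)
  have hsb : IsSymmSndFDerivAt ℝ b y := hb.isSymmSndFDerivAt (by simp)
  have k1 : fderiv ℝ (fun z => fderiv ℝ b z w) y (U y) = fderiv ℝ (fderiv ℝ b) y (U y) w := by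
    rw [fderiv_fderiv_apply hb (differentiableAt_const w)]; simp
  have k2 : fderiv ℝ (fun z => fderiv ℝ a z w) y (V y) = fderiv ℝ (fderiv ℝ a) y (V y) w := by
    rw [fderiv_fderiv_apply ha (differentiableAt_const w)]; simp
  have l1 : lieBracket ℝ U (fun _ => w) y = -fderiv ℝ U y w := by simp [lieBracket_eq]
  have l2 : lieBracket ℝ V (fun _ => w) y = -fderiv ℝ V y w := by simp [lieBracket_eq]
  rw [hclosed] at H
  have s3 (F : Fin (1 + 2) → ℝ) : ∑ i, F i = F 0 + F 1 + F 2 := Fin.sum_univ_three F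
  have s2 (F : Fin (1 + 1) → ℝ) : ∑ i, F i = F 0 + F 1 := Fin.sum_univ_two F
  have i0 : Finset.Ici (0 : Fin (1 + 1)) = {0, 1} := by decide
  have i1 : Finset.Ici (1 : Fin (1 + 1)) = {1} := by decide
  have t1 (X : E) : (Matrix.vecCons X (Fin.removeNth 0 (Fin.removeNth (Fin.castSucc 0)
      fun i => (![U, V, fun _ => w] : Fin 3 → E → E) i y)) : Fin 2 → E) = ![X, w] := by
    ext i; fin_cases i <;> rfl
  have t2 (X : E) : (Matrix.vecCons X (Fin.removeNth 1 (Fin.removeNth (Fin.castSucc 0)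
      fun i => (![U, V, fun _ => w] : Fin 3 → E → E) i y)) : Fin 2 → E) = ![X, V y] := by
    ext i; fin_cases i <;> rfl
  have t3 (X : E) : (Matrix.vecCons X (Fin.removeNth 1 (Fin.removeNth (Fin.castSucc 1)
      fun i => (![U, V, fun _ => w] : Fin 3 → E → E) i y)) : Fin 2 → E) = ![X, U y] := by
    ext i; fin_cases i <;> rfl
  rw [s3, s2, i0, i1, Finset.sum_pair (by decide), Finset.sum_singleton, e1, e2, e3, t1, t2, t3,
    f1.fderiv_eq, f2.fderiv_eq, f3.fderiv_eq] at H
  -- `0 = U β(V, w) - V β(U, w) + w β(U, V) - β([U, V], w) + β([U, w], V) - β([V, w], U)`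
  have H' : (0 : ℝ) =
      (-1 : ℤ) ^ 0 • fderiv ℝ (fun z => fderiv ℝ b z w) y (U y)
        + (-1 : ℤ) ^ 1 • fderiv ℝ (fun z => fderiv ℝ a z w) y (V y)
        + (-1 : ℤ) ^ 2 • fderiv ℝ (fun z => -fderiv ℝ b z (U z)) y w
      - ((-1 : ℤ) ^ (0 + 0) • β y ![lieBracket ℝ U V y, w]
        + (-1 : ℤ) ^ (0 + 1) • β y ![lieBracket ℝ U (fun _ => w) y, V y]
        + (-1 : ℤ) ^ (1 + 1) • β y ![lieBracket ℝ V (fun _ => w) y, U y]) := H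
  norm_num [g3, k1, k2, l1, l2] at H'
  rw [alternating_pair_swap _ _ (V y), alternating_pair_swap _ _ (U y), hVb.self_of_nhds,
    hUa.self_of_nhds, map_neg, map_neg, hsb.eq (U y) w, hsa.eq (V y) w] at H'
  rw [fderiv_fderiv_apply hb hU] at H' ⊢
  rw [fderiv_fderiv_apply hb hU] at g3'
  linarith

end Flat

/-! ### Coordinate expressions of vector fields -/

section Chart

variable {E M : Type*} [NormedAddCommGroup E] [NormedSpace ℝ E]
  [TopologicalSpace M] [ChartedSpace E M]

/-- The expression of a vector field in the chart at `x₀`. Meaningful on the target of the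
chart. -/
def chartField [IsManifold 𝓘(ℝ, E) ∞ M] (X : VecField E M) (x₀ : M) (y : E) : E :=
  VectorField.mpullback 𝓘(ℝ, E) 𝓘(ℝ, E) (extChartAt 𝓘(ℝ, E) x₀).symm X y

variable [IsManifold 𝓘(ℝ, E) ∞ M]

theorem isInvertible_mfderiv_extChartAt_symm {x₀ : M} {y : E}
    (hy : y ∈ (extChartAt 𝓘(ℝ, E) x₀).target) :
    (mfderiv 𝓘(ℝ, E) 𝓘(ℝ, E) (extChartAt 𝓘(ℝ, E) x₀).symm y).IsInvertible := by
  have := isInvertible_mfderivWithin_extChartAt_symm (I := 𝓘(ℝ, E)) hy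
  simpa only [modelWithCornersSelf_coe, Set.range_id, mfderivWithin_univ] using this

/-- Stated for endomorphisms of the model space, so that it applies to derivatives of charts with
tangent spaces unfolded to `E`: tangent spaces carry no norm. -/
theorem apply_inverse_of_isInvertible {A : E →L[ℝ] E} (hA : A.IsInvertible) (v : E) :
    A (A.inverse v) = v := by
  obtain ⟨e, rfl⟩ := hA
  simp

theorem mfderiv_symm_chartField (X : VecField E M) {x₀ : M} {y : E}
    (hy : y ∈ (extChartAt 𝓘(ℝ, E) x₀).target) :
    mfderiv 𝓘(ℝ, E) 𝓘(ℝ, E) (extChartAt 𝓘(ℝ, E) x₀).symm y (chartField (E := E) X x₀ y) =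
      X ((extChartAt 𝓘(ℝ, E) x₀).symm y) := by
  have h := isInvertible_mfderiv_extChartAt_symm hy
  exact apply_inverse_of_isInvertible (E := E) h _

theorem chartField_extChartAt (X : VecField E M) (x₀ : M) :
    chartField X x₀ (extChartAt 𝓘(ℝ, E) x₀ x₀) =
      mfderiv 𝓘(ℝ, E) 𝓘(ℝ, E) (extChartAt 𝓘(ℝ, E) x₀) x₀ (X x₀) := by
  set φ := extChartAt 𝓘(ℝ, E) x₀ with hφ
  have hy : φ x₀ ∈ φ.target := mem_extChartAt_target x₀
  have h := mfderiv_extChartAt_comp_mfderivWithin_extChartAt_symm (I := 𝓘(ℝ, E)) hy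
  simp only [modelWithCornersSelf_coe, Set.range_id, mfderivWithin_univ] at h
  have h1 : mfderiv 𝓘(ℝ, E) 𝓘(ℝ, E) φ (φ.symm (φ x₀)) (X (φ.symm (φ x₀))) =
      chartField X x₀ (φ x₀) := by
    rw [← mfderiv_symm_chartField X hy]
    exact DFunLike.congr_fun h (chartField X x₀ (φ x₀))
  rw [← h1]
  exact congrArg (fun x => (mfderiv 𝓘(ℝ, E) 𝓘(ℝ, E) φ x (X x) : E)) (extChartAt_to_inv x₀)

theorem differentiableAt_chartField [CompleteSpace E] (X : VecField E M) (x₀ : M) :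
    DifferentiableAt ℝ (chartField X x₀) (extChartAt 𝓘(ℝ, E) x₀ x₀) := by
  have h := VectorField.contMDiffWithinAt_mpullbackWithin_extChartAt_symm (n := ∞) (m := 1)
    (s := Set.univ) ((X.contMDiff x₀).of_le ENat.LEInfty.out).contMDiffWithinAt uniqueMDiffOn_univ
    (Set.mem_univ x₀) (by rw [one_add_one_eq_two]; exact ENat.LEInfty.out)
  have h2 := h.contMDiffAt (by
    rw [Set.preimage_univ, Set.inter_univ]
    exact (isOpen_extChartAt_target x₀).mem_nhds (mem_extChartAt_target x₀))
  rw [contMDiffAt_vectorSpace_iff_contDiffAt] at h2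
  have h3 := h2.differentiableAt (by simp)
  simp only [modelWithCornersSelf_coe, Set.range_id, VectorField.mpullbackWithin_univ] at h3
  exact h3

/-- At the centre of a chart, the Lie bracket on the manifold is computed by the Lie bracket of
the coordinate expressions. -/
theorem chartField_bracket [CompleteSpace E] (X Y : VecField E M) (x₀ : M) :
    chartField (bracket X Y) x₀ (extChartAt 𝓘(ℝ, E) x₀ x₀) =
      VectorField.lieBracket ℝ (chartField X x₀) (chartField Y x₀) (extChartAt 𝓘(ℝ, E) x₀ x₀) := by
  set φ := extChartAt 𝓘(ℝ, E) x₀ with hφ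
  have h : bracket X Y x₀ =
      (show E →L[ℝ] E from mfderiv 𝓘(ℝ, E) 𝓘(ℝ, E) φ x₀).inverse
        (VectorField.lieBracket ℝ (chartField X x₀) (chartField Y x₀) (φ x₀)) := by
    change VectorField.mlieBracketWithin 𝓘(ℝ, E) X Y Set.univ x₀ = _
    rw [VectorField.mlieBracketWithin_apply]
    simp only [modelWithCornersSelf_coe, Set.range_id, VectorField.mpullbackWithin_univ,
      Set.preimage_univ, Set.inter_univ]
    rw [← VectorField.lieBracketWithin_univ]
    rfl
  rw [chartField_extChartAt, h]
  exact apply_inverse_of_isInvertible (E := E)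
    (isInvertible_mfderiv_extChartAt (mem_extChartAt_source x₀)) _

theorem contDiffAt_comp_extChartAt_symm (f : SmoothFun E M) {x₀ : M} {y : E}
    (hy : y ∈ (extChartAt 𝓘(ℝ, E) x₀).target) :
    ContDiffAt ℝ ∞ (f ∘ (extChartAt 𝓘(ℝ, E) x₀).symm) y :=
  (f.contMDiff.comp_contMDiffOn (contMDiffOn_extChartAt_symm x₀)).contDiffOn.contDiffAt
    ((isOpen_extChartAt_target x₀).mem_nhds hy)

theorem fderiv_comp_extChartAt_symm (f : SmoothFun E M) {x₀ : M} {y : E}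
    (hy : y ∈ (extChartAt 𝓘(ℝ, E) x₀).target) (w : E) :
    fderiv ℝ (f ∘ (extChartAt 𝓘(ℝ, E) x₀).symm) y w =
      mvfderiv 𝓘(ℝ, E) f ((extChartAt 𝓘(ℝ, E) x₀).symm y)
        (mfderiv 𝓘(ℝ, E) 𝓘(ℝ, E) (extChartAt 𝓘(ℝ, E) x₀).symm y w) := by
  have hφd : MDifferentiableAt 𝓘(ℝ, E) 𝓘(ℝ, E) (extChartAt 𝓘(ℝ, E) x₀).symm y :=
    ((contMDiffOn_extChartAt_symm (n := ∞) x₀).contMDiffAt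
      ((isOpen_extChartAt_target x₀).mem_nhds hy)).mdifferentiableAt (by simp)
  have hfd : MDifferentiableAt 𝓘(ℝ, E) 𝓘(ℝ, ℝ) f ((extChartAt 𝓘(ℝ, E) x₀).symm y) :=
    f.mdifferentiableAt
  rw [← mfderiv_eq_fderiv, mfderiv_comp y hfd hφd]
  rfl

/-- In coordinates, `X f` is the derivative of `f` along the coordinate expression of `X`. -/
theorem lieDeriv_extChartAt_symm (X : VecField E M) (f : SmoothFun E M) {x₀ : M} {y : E}
    (hy : y ∈ (extChartAt 𝓘(ℝ, E) x₀).target) :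
    lieDeriv X f ((extChartAt 𝓘(ℝ, E) x₀).symm y) =
      fderiv ℝ (f ∘ (extChartAt 𝓘(ℝ, E) x₀).symm) y (chartField X x₀ y) := by
  rw [fderiv_comp_extChartAt_symm f hy, mfderiv_symm_chartField X hy]
  rfl

theorem fderiv_lieDeriv_extChartAt_symm (X : VecField E M) (f : SmoothFun E M) {x₀ : M} {y : E}
    (hy : y ∈ (extChartAt 𝓘(ℝ, E) x₀).target) :
    fderiv ℝ (lieDeriv X f ∘ (extChartAt 𝓘(ℝ, E) x₀).symm) y =
      fderiv ℝ (fun z => fderiv ℝ (f ∘ (extChartAt 𝓘(ℝ, E) x₀).symm) z (chartField X x₀ z)) y := by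
  refine Filter.EventuallyEq.fderiv_eq ?_
  filter_upwards [(isOpen_extChartAt_target x₀).mem_nhds hy] with z hz
  exact lieDeriv_extChartAt_symm X f hz

/-- `[X, Y] f = X (Y f) - Y (X f)`. -/
theorem lieDeriv_bracket [CompleteSpace E] (X Y : VecField E M) (f : SmoothFun E M) :
    lieDeriv (bracket X Y) f = lieDeriv X (lieDeriv Y f) - lieDeriv Y (lieDeriv X f) := by
  ext x
  have hx : extChartAt 𝓘(ℝ, E) x x ∈ (extChartAt 𝓘(ℝ, E) x).target := mem_extChartAt_target x
  have key (Z : VecField E M) (g : SmoothFun E M) := lieDeriv_extChartAt_symm Z g hx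
  simp only [extChartAt_to_inv] at key
  rw [ContMDiffMap.coe_sub, Pi.sub_apply, key, key, key, chartField_bracket,
    fderiv_lieDeriv_extChartAt_symm _ _ hx, fderiv_lieDeriv_extChartAt_symm _ _ hx]
  exact fderiv_lieBracket ((contDiffAt_comp_extChartAt_symm f hx).of_le ENat.LEInfty.out)
    (differentiableAt_chartField X x) (differentiableAt_chartField Y x)

/-- The equation `ι_{X_f} Ω = df` in coordinates. -/
theorem chartForm_hamiltonian [FiniteDimensional ℝ E] (Ω : SymplecticForm E M)
    (f : SmoothFun E M) {x₀ : M} {y : E} (hy : y ∈ (extChartAt 𝓘(ℝ, E) x₀).target) (w : E) :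
    chartForm Ω x₀ y ![chartField (Ω.hamiltonian f) x₀ y, w] =
      fderiv ℝ (f ∘ (extChartAt 𝓘(ℝ, E) x₀).symm) y w := by
  rw [fderiv_comp_extChartAt_symm f hy]
  refine Eq.trans ?_ (Ω.hamiltonianAt_spec f _ _)
  refine congrArg (Ω ((extChartAt 𝓘(ℝ, E) x₀).symm y)) ?_
  funext i
  fin_cases i
  · exact mfderiv_symm_chartField (Ω.hamiltonian f) hy
  · rfl

end Chart

/-! ### The Poisson algebra -/

section Poisson

variable {E M : Type*} [NormedAddCommGroup E] [NormedSpace ℝ E]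
  [TopologicalSpace M] [ChartedSpace E M]

theorem SymplecticForm.eq_of_forall_apply (Ω : SymplecticForm E M) {x : M}
    {v v' : TangentSpace 𝓘(ℝ, E) x} (h : ∀ w, Ω x ![v, w] = Ω x ![v', w]) : v = v' := by
  rw [← sub_eq_zero]
  refine Ω.nondegenerate x _ fun w => ?_
  change flat (Ω x) (v - v') w = 0
  rw [map_sub, LinearMap.sub_apply, sub_eq_zero]
  exact h w

theorem mvfderiv_const_smul (c : ℝ) (f : SmoothFun E M) (x : M) :
    mvfderiv 𝓘(ℝ, E) (c • f : SmoothFun E M) x = c • mvfderiv 𝓘(ℝ, E) f x := by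
  have h := mvfderiv_smul (I := 𝓘(ℝ, E)) (x := x) (a := fun _ : M => c)
    mdifferentiableAt_const (f.mdifferentiableAt (x := x))
  rw [mvfderiv_const] at h
  refine h.trans ?_
  ext v
  simp

variable [IsManifold 𝓘(ℝ, E) ∞ M]

theorem lieDeriv_add (X : VecField E M) (f g : SmoothFun E M) :
    lieDeriv X (f + g) = lieDeriv X f + lieDeriv X g := by
  ext x
  exact DFunLike.congr_fun (mvfderiv_add f.mdifferentiableAt g.mdifferentiableAt) (X x)

theorem lieDeriv_neg (X : VecField E M) (f : SmoothFun E M) :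
    lieDeriv X (-f) = -lieDeriv X f := by
  ext x
  exact DFunLike.congr_fun (mvfderiv_neg (g := f)) (X x)

variable [FiniteDimensional ℝ E] (Ω : SymplecticForm E M)

/-- `{f, g} = X_f g`. -/
theorem SymplecticForm.poisson_eq_lieDeriv (f g : SmoothFun E M) :
    Ω.poisson f g = lieDeriv (Ω.hamiltonian f) g := by
  ext x
  change -Ω x ![Ω.hamiltonianAt f x, Ω.hamiltonianAt g x] = _
  rw [alternating_pair_swap, neg_neg]
  exact Ω.hamiltonianAt_spec g x _

theorem SymplecticForm.poisson_skew (f g : SmoothFun E M) :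
    Ω.poisson f g = -Ω.poisson g f := by
  ext x
  exact congrArg Neg.neg (alternating_pair_swap (Ω x) _ _)

theorem SymplecticForm.hamiltonian_add (f g : SmoothFun E M) :
    Ω.hamiltonian (f + g) = Ω.hamiltonian f + Ω.hamiltonian g := by
  ext x
  refine Ω.eq_of_forall_apply fun w => (Ω.hamiltonianAt_spec (f + g) x w).trans ?_
  change _ = flat (Ω x) (Ω.hamiltonianAt f x + Ω.hamiltonianAt g x) w
  rw [map_add, LinearMap.add_apply]
  refine (DFunLike.congr_fun (mvfderiv_add f.mdifferentiableAt g.mdifferentiableAt) w).trans ?_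
  exact congrArg₂ (· + ·) (Ω.hamiltonianAt_spec f x w).symm (Ω.hamiltonianAt_spec g x w).symm

theorem SymplecticForm.hamiltonian_smul (c : ℝ) (f : SmoothFun E M) :
    Ω.hamiltonian (c • f) = c • Ω.hamiltonian f := by
  ext x
  refine Ω.eq_of_forall_apply fun w => (Ω.hamiltonianAt_spec (c • f) x w).trans ?_
  change _ = flat (Ω x) (c • Ω.hamiltonianAt f x) w
  rw [map_smul, LinearMap.smul_apply, mvfderiv_const_smul]
  exact congrArg (c • ·) (Ω.hamiltonianAt_spec f x w).symm

/-- `[X_f, X_g]` is the Hamiltonian vector field of `{f, g}`. This is where `dΩ = 0` enters. -/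
theorem SymplecticForm.bracket_hamiltonian (f g : SmoothFun E M) :
    bracket (Ω.hamiltonian f) (Ω.hamiltonian g) = Ω.hamiltonian (Ω.poisson f g) := by
  have : CompleteSpace E := FiniteDimensional.complete ℝ E
  ext x
  set φ := extChartAt 𝓘(ℝ, E) x with hφ
  have hx : φ x ∈ φ.target := mem_extChartAt_target x
  have hnhds : φ.target ∈ nhds (φ x) := (isOpen_extChartAt_target x).mem_nhds hx
  -- the equality paired with `w`, in the chart at `x`
  have key (w : E) :
      chartForm Ω x (φ x) ![chartField (bracket (Ω.hamiltonian f) (Ω.hamiltonian g)) x (φ x), w] =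
        chartForm Ω x (φ x) ![chartField (Ω.hamiltonian (Ω.poisson f g)) x (φ x), w] := by
    rw [chartField_bracket, chartForm_hamiltonian Ω _ hx, Ω.poisson_eq_lieDeriv,
      fderiv_lieDeriv_extChartAt_symm _ _ hx]
    refine lieBracket_hamiltonian (a := f ∘ φ.symm)
      (((Ω.smooth x).contDiffAt hnhds).differentiableAt (by simp))
      (Ω.closed x _ hx) (differentiableAt_chartField _ x) (differentiableAt_chartField _ x)
      ((contDiffAt_comp_extChartAt_symm f hx).of_le ENat.LEInfty.out)
      ((contDiffAt_comp_extChartAt_symm g hx).of_le ENat.LEInfty.out) ?_ ?_ w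
    · filter_upwards [hnhds] with z hz using chartForm_hamiltonian Ω f hz
    · filter_upwards [hnhds] with z hz using chartForm_hamiltonian Ω g hz
  -- back on the manifold, where `φ.symm (φ x)` is only propositionally equal to `x`
  have key' (w : TangentSpace 𝓘(ℝ, E) (φ.symm (φ x))) :
      Ω (φ.symm (φ x)) ![bracket (Ω.hamiltonian f) (Ω.hamiltonian g) (φ.symm (φ x)), w] =
        Ω (φ.symm (φ x)) ![Ω.hamiltonian (Ω.poisson f g) (φ.symm (φ x)), w] := by
    obtain ⟨u, rfl⟩ : ∃ u : E, mfderiv 𝓘(ℝ, E) 𝓘(ℝ, E) φ.symm (φ x) u = w :=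
      ⟨_, apply_inverse_of_isInvertible (E := E)
        (isInvertible_mfderiv_extChartAt_symm (E := E) hx) w⟩
    have e (Z : VecField E M) : Ω (φ.symm (φ x))
        ![Z (φ.symm (φ x)), mfderiv 𝓘(ℝ, E) 𝓘(ℝ, E) φ.symm (φ x) u] =
        chartForm Ω x (φ x) ![chartField Z x (φ x), u] := by
      refine congrArg (Ω (φ.symm (φ x))) ?_
      funext i
      fin_cases i
      · exact (mfderiv_symm_chartField Z hx).symm
      · rfl
    rw [e, e, key]
  have h := Ω.eq_of_forall_apply key'
  rwa [extChartAt_to_inv] at h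

theorem SymplecticForm.isLieBracket_poisson : IsLieBracket Ω.poisson where
  add_left f g h := by
    rw [Ω.poisson_skew, Ω.poisson_eq_lieDeriv, lieDeriv_add, ← Ω.poisson_eq_lieDeriv,
      ← Ω.poisson_eq_lieDeriv, Ω.poisson_skew h f, Ω.poisson_skew h g]
    abel
  smul_left c f g := by
    rw [Ω.poisson_eq_lieDeriv, Ω.hamiltonian_smul, Ω.poisson_eq_lieDeriv]
    ext x
    exact map_smul (mvfderiv 𝓘(ℝ, E) g x) c _
  skew := Ω.poisson_skew
  jacobi f g h := by
    -- `{{f, g}, h} = [X_f, X_g] h = {f, {g, h}} - {g, {f, h}}`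
    have : CompleteSpace E := FiniteDimensional.complete ℝ E
    have h1 : Ω.poisson h (Ω.poisson f g) =
        Ω.poisson g (Ω.poisson f h) - Ω.poisson f (Ω.poisson g h) := by
      rw [Ω.poisson_skew, Ω.poisson_eq_lieDeriv, ← Ω.bracket_hamiltonian, lieDeriv_bracket]
      simp only [Ω.poisson_eq_lieDeriv]
      abel
    have h2 : Ω.poisson g (Ω.poisson h f) = -Ω.poisson g (Ω.poisson f h) := by
      rw [Ω.poisson_skew h f, Ω.poisson_eq_lieDeriv, lieDeriv_neg, ← Ω.poisson_eq_lieDeriv]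
    rw [h1, h2]
    abel

end Poisson

/-! ### Prequantum operators -/

section Operators

variable {E M : Type*} [NormedAddCommGroup E] [NormedSpace ℝ E]
  [TopologicalSpace M] [ChartedSpace E M]
  {L : M → Type*} [TopologicalSpace (TotalSpace ℂ L)] [∀ x, TopologicalSpace (L x)]
  [FiberBundle ℂ L] [∀ x, AddCommGroup (L x)] [∀ x, Module ℂ (L x)] [VectorBundle ℂ ℂ L]
  [∀ x, Module ℝ (L x)] [∀ x, IsScalarTower ℝ ℂ (L x)] [VectorBundle ℝ ℂ L]

theorem mulOp_add (f g : SmoothFun E M) :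
    (mulOp (f + g) : Module.End ℂ (LineSection E L)) = mulOp f + mulOp g := by
  ext s x
  exact add_smul (f x) (g x) (s x)

theorem mulOp_neg (f : SmoothFun E M) :
    (mulOp (-f) : Module.End ℂ (LineSection E L)) = -mulOp f := by
  ext s x
  exact neg_smul (f x) (s x)

theorem mulOp_smul (c : ℝ) (f : SmoothFun E M) :
    (mulOp (c • f) : Module.End ℂ (LineSection E L)) = (c : ℂ) • mulOp f := by
  ext s x
  change (c * f x) • s x = (c : ℂ) • (f x • s x)
  rw [mul_smul, ← algebraMap_smul ℂ c (f x • s x)]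
  rfl

theorem mulOp_mul_comm (f g : SmoothFun E M) :
    (mulOp f * mulOp g : Module.End ℂ (LineSection E L)) = mulOp g * mulOp f := by
  ext s x
  exact smul_comm (f x) (g x) (s x)

namespace Connection

variable [IsManifold 𝓘(ℝ, E) ∞ M] (D : Connection E L)

theorem nabla_smul (c : ℝ) (X : VecField E M) : D.nabla (c • X) = (c : ℂ) • D.nabla X := by
  ext s x
  have h := D.fmul_field (ContMDiffMap.const c) X s
  -- `ℝ`-linearity in the field is `C^∞(M)`-linearity for constant functions
  have h1 : fmul (ContMDiffMap.const c : SmoothFun E M) X = c • X := rfl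
  rw [h1] at h
  rw [h]
  exact (algebraMap_smul ℂ c (D.nabla X s x)).symm

/-- The Leibniz rule as a commutation relation: `[∇_X, f] = X f`. -/
theorem nabla_mul_mulOp (X : VecField E M) (f : SmoothFun E M) :
    D.nabla X * mulOp f = mulOp f * D.nabla X + mulOp (lieDeriv X f) := by
  ext1 s
  exact D.leibniz X f s

variable [FiniteDimensional ℝ E] (Ω : SymplecticForm E M) (ħ : ℝ)

/-- On Hamiltonian vector fields the prequantum condition reads
`[∇_{X_f}, ∇_{X_g}] = ∇_X + (i/ħ) {f, g}`, where `X` is the Hamiltonian vector field of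
`{f, g}`. -/
theorem nabla_hamiltonian_commutator (hD : D.IsPrequantum Ω ħ) (f g : SmoothFun E M) :
    D.nabla (Ω.hamiltonian f) * D.nabla (Ω.hamiltonian g) -
        D.nabla (Ω.hamiltonian g) * D.nabla (Ω.hamiltonian f) =
      D.nabla (Ω.hamiltonian (Ω.poisson f g)) + (Complex.I / (ħ : ℂ)) • mulOp (Ω.poisson f g) := by
  rw [← sub_eq_iff_eq_add', ← Ω.bracket_hamiltonian]
  ext s x
  refine (hD (Ω.hamiltonian f) (Ω.hamiltonian g) s x).trans ?_
  change _ = (Complex.I / (ħ : ℂ)) •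
    ((-Ω x ![Ω.hamiltonian f x, Ω.hamiltonian g x] : ℝ) • s x)
  rw [← algebraMap_smul ℂ (-Ω x ![Ω.hamiltonian f x, Ω.hamiltonian g x]) (s x), smul_smul,
    Complex.coe_algebraMap, Complex.ofReal_neg, mul_neg, neg_mul]

theorem quantize'_add (f g : SmoothFun E M) :
    D.quantize' Ω ħ (f + g) = D.quantize' Ω ħ f + D.quantize' Ω ħ g := by
  rw [quantize', Ω.hamiltonian_add, D.add_field, mulOp_add, quantize', quantize']
  module

theorem quantize'_smul (c : ℝ) (f : SmoothFun E M) :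
    D.quantize' Ω ħ (c • f) = (c : ℂ) • D.quantize' Ω ħ f := by
  rw [quantize', Ω.hamiltonian_smul, D.nabla_smul, mulOp_smul, quantize']
  module

/-- With `[∇_{X_f}, g] = {f, g} = -[∇_{X_g}, f]`, the two mixed commutators contribute
`-2(i/ħ){f, g}` and the curvature `+(i/ħ){f, g}`; together they give the zeroth-order term of
`Q'({f, g})`. -/
theorem quantize'_commutator (hD : D.IsPrequantum Ω ħ) (f g : SmoothFun E M) :
    ⁅D.quantize' Ω ħ f, D.quantize' Ω ħ g⁆ = D.quantize' Ω ħ (Ω.poisson f g) := by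
  have h1 := D.nabla_hamiltonian_commutator Ω ħ hD f g
  have h2 := D.nabla_mul_mulOp (Ω.hamiltonian f) g
  have h3 := D.nabla_mul_mulOp (Ω.hamiltonian g) f
  rw [← Ω.poisson_eq_lieDeriv] at h2 h3
  rw [Ω.poisson_skew g f, mulOp_neg] at h3
  rw [sub_eq_iff_eq_add] at h1
  rw [Ring.lie_def]
  simp only [quantize', sub_mul, mul_sub, smul_mul_assoc, mul_smul_comm, h1, h2, h3,
    mulOp_mul_comm g f]
  module

/-- The two prequantum operators differ by the scalar `-iħ`. -/
theorem quantize_eq_smul (hħ : ħ ≠ 0) (f : SmoothFun E M) :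
    D.quantize Ω ħ f = (-(Complex.I * (ħ : ℂ))) • D.quantize' Ω ħ f := by
  have hc : -(Complex.I * (ħ : ℂ)) * (Complex.I / (ħ : ℂ)) = 1 := by
    have : (ħ : ℂ) ≠ 0 := Complex.ofReal_ne_zero.2 hħ
    field_simp
    simp
  rw [quantize, quantize', smul_sub, smul_smul, hc, one_smul]

end Connection

end Operators

end

end Prequantum

theorem mainTheorem1
    {E : Type*} [NormedAddCommGroup E] [NormedSpace ℝ E] [FiniteDimensional ℝ E]
    {M : Type*} [TopologicalSpace M] [T2Space M] [SigmaCompactSpace M]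
    [ChartedSpace E M] [IsManifold 𝓘(ℝ, E) ∞ M]
    (Ω : Prequantum.SymplecticForm E M)
    -- a smooth complex line bundle over `M`
    {L : M → Type*} [TopologicalSpace (TotalSpace ℂ L)] [∀ x, TopologicalSpace (L x)]
    [FiberBundle ℂ L] [∀ x, AddCommGroup (L x)] [∀ x, Module ℂ (L x)] [VectorBundle ℂ ℂ L]
    [∀ x, Module ℝ (L x)] [∀ x, IsScalarTower ℝ ℂ (L x)] [VectorBundle ℝ ℂ L]
    [ContMDiffVectorBundle ∞ ℂ L 𝓘(ℝ, E)]
    (D : Prequantum.Connection E L) (ħ : ℝ) (hħ : ħ ≠ 0) (hD : D.IsPrequantum Ω ħ) :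
    -- the Poisson algebra is a Lie algebra
    Prequantum.IsLieBracket Ω.poisson ∧
    -- `Q` is linear and satisfies the bracket identity
    (∀ f g, D.quantize Ω ħ (f + g) = D.quantize Ω ħ f + D.quantize Ω ħ g) ∧
    (∀ (c : ℝ) f, D.quantize Ω ħ (c • f) = (c : ℂ) • D.quantize Ω ħ f) ∧
    (∀ f g, ⁅D.quantize Ω ħ f, D.quantize Ω ħ g⁆ =
      (-(Complex.I * (ħ : ℂ))) • D.quantize Ω ħ (Ω.poisson f g)) ∧
    -- the rescaled assignment is a homomorphism of Lie algebras
    (∀ f g, D.quantize' Ω ħ (f + g) = D.quantize' Ω ħ f + D.quantize' Ω ħ g) ∧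
    (∀ (c : ℝ) f, D.quantize' Ω ħ (c • f) = (c : ℂ) • D.quantize' Ω ħ f) ∧
    (∀ f g, ⁅D.quantize' Ω ħ f, D.quantize' Ω ħ g⁆ = D.quantize' Ω ħ (Ω.poisson f g)) := by
  refine ⟨Ω.isLieBracket_poisson, fun f g => ?_, fun c f => ?_, fun f g => ?_,
    D.quantize'_add Ω ħ, D.quantize'_smul Ω ħ, D.quantize'_commutator Ω ħ hD⟩
  · simp only [D.quantize_eq_smul Ω ħ hħ, D.quantize'_add, smul_add]
  · rw [D.quantize_eq_smul Ω ħ hħ, D.quantize_eq_smul Ω ħ hħ, D.quantize'_smul, smul_comm]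
  · rw [D.quantize_eq_smul Ω ħ hħ, D.quantize_eq_smul Ω ħ hħ, D.quantize_eq_smul Ω ħ hħ,
      ← D.quantize'_commutator Ω ħ hD, Ring.lie_def, Ring.lie_def]
    simp only [smul_mul_assoc, mul_smul_comm, smul_sub]
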